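/- Let $X=\{0,1\}^\kappa$, identified with $\{0,\dots,2^\kappa-1\}$ through binary expansion, let $Y$ be a finite set, let $N\ge 0$, $T\ge 0$ and $k\ge 1$ be integers, and let $x_0\in X$. Let $h_0,\dots,h_{N-1}:X\times Y\to X$ be independent uniformly random functions. A chain of proofs of work (PoWs) of length $l\le N$ is a sequence $y_0,\dots,y_{l-1}\in Y$ such that the values $x_{i+1}:=h_i(x_i,y_i)$ satisfy $x_{i+1}\le T$ for all $0\le i<l$. Let $p:=|\{v\in X: v\le T\}|/2^\kappa$ be the probability that a single evaluation gives a PoW, and assume $p\le 3/4$. A quantum adversary with $N$ queries has registers $|i,x,y,z,w\rangle$ ($0\le i<N$, $x,z\in X$, $y\in Y$, $w$ in an arbitrary finite workspace); it starts in an arbitrary fixed unit vector, applies arbitrary fixed unitaries before, between and after $N$ queries $|i,x,y,z,w\rangle\mapsto|i,x,y,z\oplus h_i(x,y),w\rangle$, finally measures all registers in the computational basis and outputs a sequence of elements of $Y$ that is a function of the outcome. The initial state, the unitaries and the output function may depend on $\kappa,N,k,T,Y,x_0$ but not on the functions $h_i$. Then, for every such adversary, the probability (over the random functions and the measurement) that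 its output is a chain of PoWs of length at least $k$ is at most $$\frac{2(1-p)}{\pi k}\left[\frac{(N+k)\,e\,\sqrt p}{k}\right]^{2k}.$$ -/

import Mathlib

namespace ChainOfPoWs

/-- Hash values: bit strings of length `κ`, read as the integers `0, …, 2 ^ κ - 1`. -/
abbrev Hash (κ : ℕ) : Type := Fin κ → Bool

/-- The integer with binary digits `x`. -/
def Hash.toNat {κ : ℕ} (x : Hash κ) : ℕ := ∑ i : Fin κ, if x i then 2 ^ (i : ℕ) else 0

/-- Bitwise exclusive or. -/
def Hash.xor {κ : ℕ} (x z : Hash κ) : Hash κ := fun i => Bool.xor (x i) (z i)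

theorem Hash.xor_xor_cancel {κ : ℕ} (z v : Hash κ) : (z.xor v).xor v = z := by
  funext i
  simp [Hash.xor]

/-- The random oracles: a family of `N` functions `h₀, …, h_{N-1} : X × Y → X`. -/
abbrev Oracle (κ N : ℕ) (Y : Type*) : Type _ := Fin N → Hash κ × Y → Hash κ

/-- The probability that a uniformly random hash value is at most `T`, i.e. that a single
(classical) evaluation of a random oracle gives a proof of work. -/
noncomputable def powProb (κ T : ℕ) : ℝ :=
  ((Finset.univ.filter fun v : Hash κ => v.toNat ≤ T).card : ℝ) / (Fintype.card (Hash κ) : ℝ)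

/-- `ys = [y₀, …, y_{l-1}]` is a chain of proofs of work starting from `x₀`: one has `l ≤ N`, and
the values given by `x_{i+1} = h_i (x_i, y_i)` satisfy `x_{i+1} ≤ T` for all `i < l`. -/
def IsPoWChain {κ N : ℕ} {Y : Type*} (h : Oracle κ N Y) (T : ℕ) (x₀ : Hash κ) (ys : List Y) :
    Prop :=
  ∃ (hl : ys.length ≤ N) (x : Fin (ys.length + 1) → Hash κ), x 0 = x₀ ∧
    ∀ i : Fin ys.length,
      x i.succ = h (Fin.castLE hl i) (x i.castSucc, ys.get i) ∧ (x i.succ).toNat ≤ T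

/-- Computational basis labels `(i, x, y, z, w)`: the index `i` of the queried oracle, the query
input `(x, y)`, the response register `z` and the private workspace `w`. -/
abbrev Label (κ N : ℕ) (Y W : Type*) : Type _ := Fin N × Hash κ × Y × Hash κ × W

/-- The basis permutation `|i, x, y, z, w⟩ ↦ |i, x, y, z ⊕ h_i(x, y), w⟩` of one query. -/
def queryPerm {κ N : ℕ} {Y : Type*} (W : Type*) (h : Oracle κ N Y) :
    Equiv.Perm (Label κ N Y W) where
  toFun b := (b.1, b.2.1, b.2.2.1, b.2.2.2.1.xor (h b.1 (b.2.1, b.2.2.1)), b.2.2.2.2)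
  invFun b := (b.1, b.2.1, b.2.2.1, b.2.2.2.1.xor (h b.1 (b.2.1, b.2.2.1)), b.2.2.2.2)
  left_inv b := by simp [Hash.xor_xor_cancel]
  right_inv b := by simp [Hash.xor_xor_cancel]

/-- The quantum query: the unitary that permutes the computational basis by `queryPerm`. -/
noncomputable def applyQuery {κ N : ℕ} {Y W : Type*} [Fintype Y] [Fintype W] (h : Oracle κ N Y)
    (ψ : EuclideanSpace ℂ (Label κ N Y W)) : EuclideanSpace ℂ (Label κ N Y W) :=
  WithLp.toLp 2 fun b => ψ ((queryPerm W h).symm b)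

/-- A quantum adversary with quantum access to `N` oracles: a unit initial state, a unitary for
each stage (the one with index `t` is applied after `t` queries), and a measurement of all the
registers in the computational basis, followed by classical post-processing of the outcome.
The unitaries, initial state and output function do not depend on the oracles. -/
structure Adversary (κ N : ℕ) (Y W : Type*) [Fintype Y] [Fintype W] where
  /-- the initial state -/
  init : EuclideanSpace ℂ (Label κ N Y W)
  norm_init : ‖init‖ = 1
  /-- the unitary applied after `t` queries -/
  U : ℕ → (EuclideanSpace ℂ (Label κ N Y W) ≃ₗᵢ[ℂ] EuclideanSpace ℂ (Label κ N Y W))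
  /-- the output computed from the measurement outcome -/
  out : Label κ N Y W → List Y

/-- The state after `t` queries to `h`, each followed by the corresponding unitary:
`U_t O_h U_{t-1} O_h ⋯ U_1 O_h U_0 |init⟩`. -/
noncomputable def Adversary.state {κ N : ℕ} {Y W : Type*} [Fintype Y] [Fintype W]
    (A : Adversary κ N Y W) (h : Oracle κ N Y) : ℕ → EuclideanSpace ℂ (Label κ N Y W)
  | 0 => A.U 0 A.init
  | t + 1 => A.U (t + 1) (applyQuery h (A.state h t))

open Classical in
/-- The probability that, for the fixed oracles `h`, the adversary outputs after `q` queries a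
chain of proofs of work of length at least `k` (Born rule). -/
noncomputable def Adversary.successProbFor {κ N : ℕ} {Y W : Type*} [Fintype Y] [Fintype W]
    (A : Adversary κ N Y W) (q T : ℕ) (x₀ : Hash κ) (k : ℕ) (h : Oracle κ N Y) : ℝ :=
  ∑ b : Label κ N Y W,
    if k ≤ (A.out b).length ∧ IsPoWChain h T x₀ (A.out b) then ‖A.state h q b‖ ^ 2 else 0

open Classical in
/-- The success probability over uniformly random, independent oracles `h₀, …, h_{N-1}`. -/
noncomputable def Adversary.successProb {κ N : ℕ} {Y W : Type*} [Fintype Y] [Fintype W]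
    (A : Adversary κ N Y W) (q T : ℕ) (x₀ : Hash κ) (k : ℕ) : ℝ :=
  (∑ h : Oracle κ N Y, A.successProbFor q T x₀ k h) / (Fintype.card (Oracle κ N Y) : ℝ)

end ChainOfPoWs

/-!
Keep the random functions in superposition: the states of the adversary, as a function of the
oracles, form one vector `F` of an `ℓ²` space, in which every entry `(i, x, y)` of the oracles is a
variable ranging over the hash values. In a single variable, with `G` the set of proofs of work,
let `P` be the projection onto the functions that are constant off `G` and have zero sum; its range
is the part of the state in which the adversary knows a proof of work at this entry. Let `W`
multiply this part by `q ≥ 1`, in all the entries at once, and call `‖W F‖²` the progress.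

* Initially `F` is constant, so `W F = F`.
* A query acts on a single entry, once its registers are fixed. The responses `z ↦ z ⊕ v` fix the
  sum of their orbits, so a query moves at most the amplitude `√(2p / (1 - p))` from the kernel of
  `P` to its range, and it multiplies the progress by at most `exp (q √(2p / (1 - p)))`.
* A function of one variable that is concentrated on `G` is mostly in the range of `P`. Hence each
  link of a chain costs a factor `p + (1 - p) / q²` in its probability relative to the progress,
  and the links of a chain are distinct entries, because each link queries its own oracle.

After `N` queries a chain of length `k` thus has probability at most
`(p + (1 - p) / q²) ^ k * exp (q N √(2p / (1 - p)))`, and `q` is chosen so that the exponential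
becomes `e ^ (2k)`. Where this `q` is below `1`, the claimed bound is at least `1`.
-/

namespace ChainOfPoWs

open Finset (univ)
open scoped Finset RealInnerProductSpace

section SymmetricProjection

variable {H : Type*} [NormedAddCommGroup H] [InnerProductSpace ℝ H] {P : H →ₗ[ℝ] H}

theorem norm_sq_eq_norm_projection_sq_add (hP : P.IsSymmetricProjection) (x : H) :
    ‖x‖ ^ 2 = ‖P x‖ ^ 2 + ‖x - P x‖ ^ 2 := by
  have horth : ⟪P x, x - P x⟫ = 0 := by
    rw [hP.isSymmetric, map_sub, ← Module.End.mul_apply, hP.isIdempotentElem, sub_self,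
      inner_zero_right]
  simpa [← sq, horth] using norm_add_sq_real (P x) (x - P x)

theorem norm_projection_le (hP : P.IsSymmetricProjection) (x : H) : ‖P x‖ ≤ ‖x‖ :=
  le_of_sq_le_sq (by linarith [norm_sq_eq_norm_projection_sq_add hP x, sq_nonneg ‖x - P x‖])
    (norm_nonneg x)

theorem norm_sub_projection_le (hP : P.IsSymmetricProjection) (x : H) : ‖x - P x‖ ≤ ‖x‖ :=
  le_of_sq_le_sq (by linarith [norm_sq_eq_norm_projection_sq_add hP x, sq_nonneg ‖P x‖])
    (norm_nonneg x)

theorem inner_projection_self (hP : P.IsSymmetricProjection) (x : H) : ⟪P x, x⟫ = ‖P x‖ ^ 2 := by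
  conv_lhs => rw [← hP.isIdempotentElem, Module.End.mul_apply, hP.isSymmetric]
  exact real_inner_self_eq_norm_sq _

/-- The operator that fixes the kernel of the projection `P` and multiplies its range by `q`. For
`q ≥ 1` its norm measures the progress of an adversary, `P` being the projection onto the states
in which progress has been made. -/
def weight (P : H →ₗ[ℝ] H) (q : ℝ) : H →ₗ[ℝ] H := (1 - P) + q • P

theorem weight_apply (P : H →ₗ[ℝ] H) (q : ℝ) (x : H) : weight P q x = x - P x + q • P x := rfl

theorem norm_weight_sq (hP : P.IsSymmetricProjection) (q : ℝ) (x : H) :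
    ‖weight P q x‖ ^ 2 = ‖x - P x‖ ^ 2 + q ^ 2 * ‖P x‖ ^ 2 := by
  have hPP : P (P x) = P x := LinearMap.congr_fun hP.isIdempotentElem x
  have hW : P (weight P q x) = q • P x := by
    simp [weight_apply, hPP]
  rw [norm_sq_eq_norm_projection_sq_add hP, hW, weight_apply, add_sub_cancel_right, norm_smul,
    mul_pow, Real.norm_eq_abs, sq_abs, add_comm]

theorem norm_sq_le_norm_weight_sq (hP : P.IsSymmetricProjection) {q : ℝ} (hq : 1 ≤ q) (x : H) :
    ‖x‖ ^ 2 ≤ ‖weight P q x‖ ^ 2 := by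
  rw [norm_weight_sq hP, norm_sq_eq_norm_projection_sq_add hP x, add_comm]
  gcongr
  exact le_mul_of_one_le_left (sq_nonneg _) (one_le_pow₀ hq)

theorem inner_weight_inv_weight (hP : P.IsSymmetricProjection) {q : ℝ} (hq : q ≠ 0) (x y : H) :
    ⟪weight P q⁻¹ x, weight P q y⟫ = ⟪x, y⟫ := by
  have hPP : P (P y) = P y := LinearMap.congr_fun hP.isIdempotentElem y
  simp only [weight_apply, inner_add_left, inner_add_right, inner_sub_left, inner_sub_right,
    real_inner_smul_left, real_inner_smul_right, hP.isSymmetric x, map_smul, hPP]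
  field_simp
  ring

theorem mul_exp_half_le_exp_sub_one {s : ℝ} (hs : 0 ≤ s) :
    s * Real.exp (s / 2) ≤ Real.exp s - 1 := by
  have hsinh : s ≤ Real.exp (s / 2) - Real.exp (-(s / 2)) := by
    linarith [Real.self_le_sinh_iff.mpr (by positivity : 0 ≤ s / 2), Real.sinh_eq (s / 2)]
  calc s * Real.exp (s / 2)
      ≤ (Real.exp (s / 2) - Real.exp (-(s / 2))) * Real.exp (s / 2) := by gcongr
    _ = Real.exp s - 1 := by
        rw [sub_mul, ← Real.exp_add, ← Real.exp_add, add_halves, neg_add_cancel, Real.exp_zero]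

theorem sq_add_mul_add_sq_le {s : ℝ} (hs : 0 ≤ s) (x y : ℝ) :
    x ^ 2 + (s * x + y) ^ 2 ≤ Real.exp s * (x ^ 2 + y ^ 2) := by
  rcases hs.eq_or_lt with rfl | hs
  · simp
  have hhalf := mul_exp_half_le_exp_sub_one hs.le
  have hsq : s ^ 2 * Real.exp s ≤ (Real.exp s - 1) ^ 2 := by
    have h := pow_le_pow_left₀ (by positivity) hhalf 2
    rwa [mul_pow, ← Real.exp_nat_mul, Nat.cast_ofNat, mul_div_cancel₀ s two_ne_zero] at h
  have hpos : 0 < Real.exp s - 1 := lt_of_lt_of_le (by positivity) hhalf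
  refine le_of_mul_le_mul_left ?_ hpos
  -- Completing the square: the difference is `((eˢ - 1) y - s x)² + ((eˢ - 1)² - s² eˢ) x²`.
  linarith [sq_nonneg ((Real.exp s - 1) * y - s * x),
    mul_le_mul_of_nonneg_right hsq (sq_nonneg x)]

theorem norm_weight_map_sq_le (hP : P.IsSymmetricProjection) {q : ℝ} (hq : 1 ≤ q) {c : ℝ}
    (hc : 0 ≤ c) (U : H →ₗᵢ[ℝ] H) (hU : ∀ x, P x = 0 → ‖P (U x)‖ ≤ c * ‖x‖) (f : H) :
    ‖weight P q (U f)‖ ^ 2 ≤ Real.exp (q * c) * ‖weight P q f‖ ^ 2 := by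
  have hker : P (f - P f) = 0 := by
    rw [map_sub, ← Module.End.mul_apply, hP.isIdempotentElem, sub_self]
  have hleak : ‖P (U f)‖ ≤ c * ‖f - P f‖ + ‖P f‖ :=
    calc ‖P (U f)‖ = ‖P (U (f - P f)) + P (U (P f))‖ := by
          rw [← map_add, ← map_add, sub_add_cancel]
      _ ≤ ‖P (U (f - P f))‖ + ‖P (U (P f))‖ := norm_add_le _ _
      _ ≤ c * ‖f - P f‖ + ‖P f‖ := by
          gcongr
          · exact hU _ hker
          · simpa using norm_projection_le hP (U (P f))
  have hq2 : 0 ≤ q ^ 2 - 1 := sub_nonneg.mpr (one_le_pow₀ hq)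
  calc ‖weight P q (U f)‖ ^ 2 = ‖U f‖ ^ 2 + (q ^ 2 - 1) * ‖P (U f)‖ ^ 2 := by
        rw [norm_weight_sq hP, norm_sq_eq_norm_projection_sq_add hP (U f)]
        ring
    _ ≤ ‖f‖ ^ 2 + (q ^ 2 - 1) * (c * ‖f - P f‖ + ‖P f‖) ^ 2 := by
        rw [U.norm_map]
        gcongr
    _ ≤ ‖f - P f‖ ^ 2 + (q * c * ‖f - P f‖ + q * ‖P f‖) ^ 2 := by
        rw [norm_sq_eq_norm_projection_sq_add hP f]
        nlinarith [mul_nonneg (mul_nonneg hc (norm_nonneg (f - P f))) (norm_nonneg (P f)),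
          sq_nonneg (c * ‖f - P f‖)]
    _ ≤ Real.exp (q * c) * ‖weight P q f‖ ^ 2 := by
        rw [norm_weight_sq hP, ← mul_pow]
        exact sq_add_mul_add_sq_le (by positivity) _ _

end SymmetricProjection

section Density

variable {X : Type*} [Fintype X]

theorem nonempty_of_ne_univ {G : Finset X} (hG : G ≠ univ) : Nonempty X :=
  not_isEmpty_iff.mp fun _ => hG (Subsingleton.elim _ _)

theorem dens_lt_one {G : Finset X} (hG : G ≠ univ) : (G.dens : ℝ) < 1 := by
  have := nonempty_of_ne_univ hG
  exact_mod_cast G.dens_le_one.lt_of_ne (Finset.dens_ne_one.mpr hG)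

theorem dens_add_div_sq_nonneg (G : Finset X) (q : ℝ) :
    0 ≤ (G.dens : ℝ) + (1 - G.dens) / q ^ 2 := by
  have h : 0 ≤ 1 - (G.dens : ℝ) := sub_nonneg.mpr (by exact_mod_cast G.dens_le_one)
  positivity

theorem dens_add_div_sq_le_one (G : Finset X) {q : ℝ} (hq : 1 ≤ q) :
    (G.dens : ℝ) + (1 - G.dens) / q ^ 2 ≤ 1 := by
  have h : 0 ≤ 1 - (G.dens : ℝ) := sub_nonneg.mpr (by exact_mod_cast G.dens_le_one)
  linarith [div_le_self h (one_le_pow₀ hq (n := 2))]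

theorem dens_compl [Nonempty X] [DecidableEq X] (G : Finset X) :
    (Gᶜ.dens : ℝ) = 1 - G.dens := by
  have h : Gᶜ.dens + G.dens = 1 := by
    rw [← Finset.dens_union_of_disjoint disjoint_compl_left, Finset.union_comm,
      Finset.union_compl, Finset.dens_univ]
  exact eq_sub_of_add_eq (by exact_mod_cast h)

end Density

section Mean

variable {X V V' : Type*} [NormedAddCommGroup V] [InnerProductSpace ℝ V]
  [NormedAddCommGroup V'] [InnerProductSpace ℝ V']

/-- The mean of a vector valued function over a finite set; it is `0` for the empty set. -/
noncomputable def mean (s : Finset X) (f : X → V) : V := (#s : ℝ)⁻¹ • ∑ v ∈ s, f v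

theorem card_smul_mean (s : Finset X) (f : X → V) : (#s : ℝ) • mean s f = ∑ v ∈ s, f v := by
  rcases s.eq_empty_or_nonempty with rfl | hs
  · simp
  · exact smul_inv_smul₀ (by simpa using hs.ne_empty) _

theorem mean_congr {s : Finset X} {f g : X → V} (h : ∀ v ∈ s, f v = g v) : mean s f = mean s g := by
  rw [mean, mean, Finset.sum_congr rfl h]

theorem mean_const {s : Finset X} (hs : s.Nonempty) (a : V) : mean s (fun _ => a) = a := by
  rw [mean, Finset.sum_const, ← Nat.cast_smul_eq_nsmul ℝ,
    inv_smul_smul₀ (by simpa using hs.ne_empty)]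

theorem map_mean (L : V →ₗ[ℝ] V') (s : Finset X) (f : X → V) :
    mean s (fun v => L (f v)) = L (mean s f) := by
  rw [mean, mean, map_smul, map_sum]

theorem card_mul_norm_mean_sq_le (s : Finset X) (f : X → V) :
    #s * ‖mean s f‖ ^ 2 ≤ ∑ v ∈ s, ‖f v‖ ^ 2 := by
  rcases s.eq_empty_or_nonempty with rfl | hs
  · simp
  have hcard : (0 : ℝ) < #s := by exact_mod_cast hs.card_pos
  refine le_of_mul_le_mul_left ?_ hcard
  calc #s * (#s * ‖mean s f‖ ^ 2) = ‖∑ v ∈ s, f v‖ ^ 2 := by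
        rw [← card_smul_mean, norm_smul, Real.norm_natCast]
        ring
    _ ≤ (∑ v ∈ s, ‖f v‖) ^ 2 := by gcongr; exact norm_sum_le _ _
    _ ≤ #s * ∑ v ∈ s, ‖f v‖ ^ 2 := sq_sum_le_card_mul_sum_sq

theorem mean_univ_of_eq_zero [Fintype X] {s : Finset X} {f : X → V} (hf : ∀ v ∉ s, f v = 0) :
    mean univ f = (s.dens : ℝ) • mean s f := by
  rw [mean, ← Finset.sum_subset s.subset_univ fun v _ => hf v, ← card_smul_mean, smul_smul,
    Finset.card_univ, Finset.nnratCast_dens, inv_mul_eq_div]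

end Mean

/-- The Hilbert space of functions `X → V` with the `ℓ²` norm. -/
abbrev L2Fun (X V : Type*) [Fintype X] [NormedAddCommGroup V] : Type _ := PiLp 2 fun _ : X => V

section SingleVariable

variable {X V V' : Type*} [Fintype X] [DecidableEq X] [NormedAddCommGroup V]
  [InnerProductSpace ℝ V] [NormedAddCommGroup V'] [InnerProductSpace ℝ V'] {G : Finset X}

/-- The operator that replaces the values of a function on `s` by their mean over `s`: the
orthogonal projection onto the functions that are constant on `s`. -/
noncomputable def averageOn (s : Finset X) : L2Fun X V →ₗ[ℝ] L2Fun X V where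
  toFun f := WithLp.toLp 2 fun v => if v ∈ s then mean s f else f v
  map_add' f g := by
    ext v
    simp only [mean, PiLp.add_apply, Finset.sum_add_distrib, smul_add]
    split_ifs <;> rfl
  map_smul' a f := by
    ext v
    simp only [mean, PiLp.smul_apply, ← Finset.smul_sum, smul_comm _ a, RingHom.id_apply]
    split_ifs <;> rfl

theorem averageOn_apply (s : Finset X) (f : L2Fun X V) (v : X) :
    averageOn s f v = if v ∈ s then mean s f else f v := rfl

theorem averageOn_univ (f : L2Fun X V) :
    averageOn univ f = WithLp.toLp 2 fun _ => mean univ f := by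
  ext v
  simp [averageOn_apply]

theorem averageOn_const (s : Finset X) (a : V) :
    averageOn s (WithLp.toLp 2 fun _ => a) = WithLp.toLp 2 fun _ => a := by
  ext v
  by_cases hv : v ∈ s
  · simp [averageOn_apply, hv, mean_const ⟨v, hv⟩]
  · simp [averageOn_apply, hv]

theorem averageOn_map (L : V →ₗ[ℝ] V') (s : Finset X) (f : L2Fun X V) (v : X) :
    averageOn s (WithLp.toLp 2 fun w => L (f w)) v = L (averageOn s f v) := by
  simp only [averageOn_apply, map_mean, apply_ite L]

theorem inner_averageOn (s : Finset X) (f g : L2Fun X V) :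
    ⟪averageOn s f, g⟫ = #s * ⟪mean s f, mean s g⟫ + ∑ v ∈ sᶜ, ⟪f v, g v⟫ := by
  rw [PiLp.inner_apply, ← Finset.sum_add_sum_compl s]
  congr 1
  · rw [Finset.sum_congr rfl fun v hv => by rw [averageOn_apply, if_pos hv], ← inner_sum,
      ← card_smul_mean, real_inner_smul_right]
  · exact Finset.sum_congr rfl fun v hv => by
      rw [averageOn_apply, if_neg (Finset.mem_compl.mp hv)]

theorem isSymmetricProjection_averageOn (s : Finset X) :
    (averageOn s : L2Fun X V →ₗ[ℝ] L2Fun X V).IsSymmetricProjection where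
  isIdempotentElem := by
    ext f v
    by_cases hv : v ∈ s
    · have hmean : mean s (averageOn s f) = mean s f :=
        (mean_congr fun w hw => by rw [averageOn_apply, if_pos hw]).trans (mean_const ⟨v, hv⟩ _)
      simp [averageOn_apply, hv, hmean]
    · simp [averageOn_apply, hv]
  isSymmetric f g := by
    rw [real_inner_comm _ f, inner_averageOn, inner_averageOn]
    simp_rw [real_inner_comm]

theorem norm_averageOn_sq (s : Finset X) (f : L2Fun X V) :
    ‖averageOn s f‖ ^ 2 = #s * ‖mean s f‖ ^ 2 + ∑ v ∈ sᶜ, ‖f v‖ ^ 2 := by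
  rw [← inner_projection_self (isSymmetricProjection_averageOn s), inner_averageOn]
  simp_rw [real_inner_self_eq_norm_sq]

theorem norm_averageOn_univ_sq (f : L2Fun X V) :
    ‖averageOn univ f‖ ^ 2 = Fintype.card X * ‖mean univ f‖ ^ 2 := by
  simp [norm_averageOn_sq]

theorem norm_averageOn_univ_sq_le_of_eq_zero {f : L2Fun X V} (hf : ∀ v ∉ G, f v = 0) :
    ‖averageOn univ f‖ ^ 2 ≤ G.dens * ‖f‖ ^ 2 := by
  calc ‖averageOn univ f‖ ^ 2 = G.dens * (#G * ‖mean G f‖ ^ 2) := by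
        rw [norm_averageOn_univ_sq, mean_univ_of_eq_zero hf, norm_smul, mul_pow, Real.norm_eq_abs,
          sq_abs, ← Finset.nnratCast_dens_mul_natCast_card]
        ring
    _ ≤ G.dens * ∑ v ∈ G, ‖f v‖ ^ 2 := by
        gcongr
        exact card_mul_norm_mean_sq_le _ _
    _ ≤ G.dens * ‖f‖ ^ 2 := by
        rw [PiLp.norm_sq_eq_of_L2]
        gcongr
        exact Finset.subset_univ _

/-- The orthogonal projection onto the functions that are constant off `G` and have zero sum. When
`f v` is the state of an adversary given that a random variable takes the value `v`, it extracts
the part of the state in which the adversary knows that this value lies in `G`. -/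
noncomputable def progressProj (G : Finset X) : L2Fun X V →ₗ[ℝ] L2Fun X V :=
  averageOn Gᶜ - averageOn univ

theorem isSymmetricProjection_progressProj (G : Finset X) :
    (progressProj G : L2Fun X V →ₗ[ℝ] L2Fun X V).IsSymmetricProjection := by
  refine (isSymmetricProjection_averageOn _).sub_of_range_le_range
    (isSymmetricProjection_averageOn _) ?_
  rintro _ ⟨f, rfl⟩
  exact ⟨averageOn univ f, by rw [averageOn_univ, averageOn_const]⟩

theorem progressProj_const (G : Finset X) (a : V) :
    progressProj G (WithLp.toLp 2 fun _ => a) = 0 := by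
  rw [progressProj, LinearMap.sub_apply, averageOn_const, averageOn_const, sub_self]

theorem progressProj_map (L : V →ₗ[ℝ] V') (G : Finset X) (f : L2Fun X V) (v : X) :
    progressProj G (WithLp.toLp 2 fun w => L (f w)) v = L (progressProj G f v) := by
  simp only [progressProj, LinearMap.sub_apply, PiLp.sub_apply, averageOn_map, map_sub]

theorem weight_progressProj_const (G : Finset X) (q : ℝ) (a : V) :
    weight (progressProj G) q (WithLp.toLp 2 fun _ => a) = WithLp.toLp 2 fun _ => a := by
  rw [weight_apply, progressProj_const, smul_zero, sub_zero, add_zero]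

theorem weight_progressProj_map (L : V →ₗ[ℝ] V') (G : Finset X) (q : ℝ) (f : L2Fun X V) (v : X) :
    weight (progressProj G) q (WithLp.toLp 2 fun w => L (f w)) v =
      L (weight (progressProj G) q f v) := by
  simp only [weight_apply, PiLp.add_apply, PiLp.sub_apply, PiLp.smul_apply, progressProj_map,
    map_add, map_sub, map_smul]

theorem norm_progressProj_sq (G : Finset X) (f : L2Fun X V) :
    ‖progressProj G f‖ ^ 2 =
      ∑ v ∈ G, ‖f v‖ ^ 2 + #Gᶜ * ‖mean Gᶜ f‖ ^ 2 - Fintype.card X * ‖mean univ f‖ ^ 2 := by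
  rw [← inner_projection_self (isSymmetricProjection_progressProj G), progressProj,
    LinearMap.sub_apply, inner_sub_left, inner_projection_self (isSymmetricProjection_averageOn _),
    inner_projection_self (isSymmetricProjection_averageOn _), norm_averageOn_univ_sq,
    norm_averageOn_sq, compl_compl, add_comm (∑ v ∈ G, _)]

theorem norm_progressProj_sq_le_of_eq_zero {f : L2Fun X V} (hf : ∀ v ∈ G, f v = 0) :
    ‖progressProj G f‖ ^ 2 ≤ G.dens * ‖f‖ ^ 2 := by
  rcases isEmpty_or_nonempty X with hX | hX
  · simp [Subsingleton.elim f 0]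
  have hmean : mean univ f = (Gᶜ.dens : ℝ) • mean Gᶜ f :=
    mean_univ_of_eq_zero fun v hv => hf v (Finset.notMem_compl.mp hv)
  calc ‖progressProj G f‖ ^ 2 = G.dens * (#Gᶜ * ‖mean Gᶜ f‖ ^ 2) := by
        rw [norm_progressProj_sq, Finset.sum_eq_zero fun v hv => by rw [hf v hv, norm_zero, sq,
          zero_mul], hmean, norm_smul, mul_pow, Real.norm_eq_abs, sq_abs,
          ← Finset.nnratCast_dens_mul_natCast_card, dens_compl]
        ring
    _ ≤ G.dens * ∑ v ∈ Gᶜ, ‖f v‖ ^ 2 := by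
        gcongr
        exact card_mul_norm_mean_sq_le _ _
    _ ≤ G.dens * ‖f‖ ^ 2 := by
        rw [PiLp.norm_sq_eq_of_L2]
        gcongr
        exact Finset.subset_univ _

theorem norm_progressProj_sq_le_of_sum_eq_zero (hG : G ≠ univ) {f : L2Fun X V}
    (hf : ∑ v, f v = 0) : ‖progressProj G f‖ ^ 2 ≤ (1 - G.dens : ℝ)⁻¹ * ∑ v ∈ G, ‖f v‖ ^ 2 := by
  have := nonempty_of_ne_univ hG
  have hG1 : (0 : ℝ) < 1 - G.dens := sub_pos.mpr (dens_lt_one hG)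
  have hmean : (1 - G.dens : ℝ) * ‖mean Gᶜ f‖ = G.dens * ‖mean G f‖ := by
    have hcompl : ‖(#Gᶜ : ℝ) • mean Gᶜ f‖ = ‖(#G : ℝ) • mean G f‖ := by
      rw [card_smul_mean, card_smul_mean,
        eq_neg_of_add_eq_zero_right ((Finset.sum_add_sum_compl G f).trans hf), norm_neg]
    rw [norm_smul, norm_smul, Real.norm_natCast, Real.norm_natCast,
      ← Finset.nnratCast_dens_mul_natCast_card, ← Finset.nnratCast_dens_mul_natCast_card G,
      dens_compl] at hcompl
    have hX : (0 : ℝ) < Fintype.card X := by exact_mod_cast Fintype.card_pos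
    exact mul_left_cancel₀ hX.ne' (by linarith)
  calc ‖progressProj G f‖ ^ 2 = ∑ v ∈ G, ‖f v‖ ^ 2 + #Gᶜ * ‖mean Gᶜ f‖ ^ 2 := by
        simp [norm_progressProj_sq, show mean univ f = 0 by rw [mean, hf, smul_zero]]
    _ = ∑ v ∈ G, ‖f v‖ ^ 2 + G.dens / (1 - G.dens) * (#G * ‖mean G f‖ ^ 2) := by
        rw [← Finset.nnratCast_dens_mul_natCast_card, ← Finset.nnratCast_dens_mul_natCast_card G,
          dens_compl]
        field_simp
        linear_combination (Fintype.card X : ℝ) * congr($hmean ^ 2)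
    _ ≤ ∑ v ∈ G, ‖f v‖ ^ 2 + G.dens / (1 - G.dens) * ∑ v ∈ G, ‖f v‖ ^ 2 := by
        gcongr
        exact card_mul_norm_mean_sq_le _ _
    _ = (1 - G.dens : ℝ)⁻¹ * ∑ v ∈ G, ‖f v‖ ^ 2 := by
        field_simp
        ring

theorem norm_progressProj_orbit_sq_le (hG : G ≠ univ) {S : X → V ≃ₗᵢ[ℝ] V}
    (hS : ∀ w a, S w (∑ v, S v a) = ∑ v, S v a) (a : V) :
    ‖progressProj G (WithLp.toLp 2 fun v => S v a)‖ ^ 2 ≤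
      G.dens / (1 - G.dens) * ‖(WithLp.toLp 2 fun v => S v a : L2Fun X V)‖ ^ 2 := by
  have hG1 : (0 : ℝ) < 1 - G.dens := sub_pos.mpr (dens_lt_one hG)
  set f : L2Fun X V := WithLp.toLp 2 fun v => S v a with hf
  set g : L2Fun X V := f - averageOn univ f with hg
  have hgv : ∀ v, g v = S v (a - mean univ f) := fun v => by
    simp only [hg, averageOn_univ, PiLp.sub_apply, map_sub, hf, mean, map_smul, hS]
  have hPg : progressProj G g = progressProj G f := by
    rw [hg, map_sub, averageOn_univ, progressProj_const, sub_zero]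
  have hsum : ∑ v, g v = 0 := by
    simp only [hg, averageOn_univ, PiLp.sub_apply]
    rw [Finset.sum_sub_distrib, Finset.sum_const, ← card_smul_mean, Nat.cast_smul_eq_nsmul,
      sub_self]
  calc ‖progressProj G f‖ ^ 2 ≤ (1 - G.dens : ℝ)⁻¹ * ∑ v ∈ G, ‖g v‖ ^ 2 := by
        rw [← hPg]
        exact norm_progressProj_sq_le_of_sum_eq_zero hG hsum
    _ = G.dens / (1 - G.dens) * ‖g‖ ^ 2 := by
        simp only [PiLp.norm_sq_eq_of_L2, hgv, LinearIsometryEquiv.norm_map, Finset.sum_const,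
          nsmul_eq_mul, Finset.card_univ, ← Finset.nnratCast_dens_mul_natCast_card G]
        ring
    _ ≤ G.dens / (1 - G.dens) * ‖f‖ ^ 2 := by
        gcongr
        exact norm_sub_projection_le (isSymmetricProjection_averageOn univ) f

theorem norm_progressProj_controlled_le (hG : G ≠ univ) {S : X → V ≃ₗᵢ[ℝ] V}
    (hS : ∀ w a, S w (∑ v, S v a) = ∑ v, S v a) {f : L2Fun X V} (hf : progressProj G f = 0) :
    ‖progressProj G (LinearIsometryEquiv.piLpCongrRight 2 S f)‖ ≤
      √(2 * G.dens / (1 - G.dens)) * ‖f‖ := by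
  have hG1 : (0 : ℝ) < 1 - G.dens := sub_pos.mpr (dens_lt_one hG)
  set U := LinearIsometryEquiv.piLpCongrRight 2 S
  set f₀ : L2Fun X V := averageOn univ f
  have hconst : ‖progressProj G (U f₀)‖ ^ 2 ≤ G.dens / (1 - G.dens) * ‖f₀‖ ^ 2 := by
    have hUf₀ : U f₀ = WithLp.toLp 2 fun v => S v (mean univ f) := by
      ext v
      simp [U, f₀, averageOn_univ]
    rw [← U.norm_map f₀, hUf₀]
    exact norm_progressProj_orbit_sq_le hG hS _
  have hoff : ‖progressProj G (U (f - f₀))‖ ^ 2 ≤ G.dens / (1 - G.dens) * ‖f - f₀‖ ^ 2 := by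
    have hzero : ∀ v ∈ G, U (f - f₀) v = 0 := fun v hv => by
      have hfv : averageOn Gᶜ f v - averageOn univ f v = 0 := congr($hf v)
      rw [averageOn_apply, if_neg (by simpa using hv)] at hfv
      simp [U, f₀, -map_sub, hfv]
    rw [← U.norm_map (f - f₀)]
    refine (norm_progressProj_sq_le_of_eq_zero hzero).trans ?_
    gcongr
    exact le_div_self (by positivity) hG1 (sub_le_self _ (by positivity))
  refine le_of_sq_le_sq ?_ (by positivity)
  calc ‖progressProj G (U f)‖ ^ 2
      ≤ (‖progressProj G (U f₀)‖ + ‖progressProj G (U (f - f₀))‖) ^ 2 := by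
        gcongr
        rw [← add_sub_cancel f₀ f, map_add, map_add, add_sub_cancel_left]
        exact norm_add_le _ _
    _ ≤ 2 * (‖progressProj G (U f₀)‖ ^ 2 + ‖progressProj G (U (f - f₀))‖ ^ 2) := add_sq_le
    _ ≤ 2 * G.dens / (1 - G.dens) * (‖f₀‖ ^ 2 + ‖f - f₀‖ ^ 2) := by
        rw [mul_div_assoc, mul_assoc, mul_add (_ / _)]
        gcongr
    _ = (√(2 * G.dens / (1 - G.dens)) * ‖f‖) ^ 2 := by
        rw [mul_pow, Real.sq_sqrt (by positivity),
          norm_sq_eq_norm_projection_sq_add (isSymmetricProjection_averageOn univ) f]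

theorem norm_weight_progressProj_inv_sq_le {q : ℝ} (hq : 1 ≤ q) {u : L2Fun X V}
    (hu : ∀ v ∉ G, u v = 0) :
    ‖weight (progressProj G) q⁻¹ u‖ ^ 2 ≤ (G.dens + (1 - G.dens) / q ^ 2) * ‖u‖ ^ 2 := by
  have hcompl : averageOn Gᶜ u = u := by
    ext v
    by_cases hv : v ∈ G
    · simp [averageOn_apply, hv]
    · have hmean : mean Gᶜ u = 0 := by
        rw [mean, Finset.sum_eq_zero fun v hv => hu v (Finset.mem_compl.mp hv), smul_zero]
      simp [averageOn_apply, hv, hu, hmean]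
  have hP : progressProj G u = u - averageOn univ u := by
    rw [progressProj, LinearMap.sub_apply, hcompl]
  have hq' : 0 ≤ 1 - (q ^ 2)⁻¹ := sub_nonneg.mpr (inv_le_one_of_one_le₀ (one_le_pow₀ hq))
  have hpyth := norm_sq_eq_norm_projection_sq_add (isSymmetricProjection_averageOn univ) u
  calc ‖weight (progressProj G) q⁻¹ u‖ ^ 2
      = (1 - (q ^ 2)⁻¹) * ‖averageOn univ u‖ ^ 2 + (q ^ 2)⁻¹ * ‖u‖ ^ 2 := by
        rw [norm_weight_sq (isSymmetricProjection_progressProj G), hP, sub_sub_cancel, inv_pow]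
        linear_combination -(q ^ 2)⁻¹ * hpyth
    _ ≤ (1 - (q ^ 2)⁻¹) * (G.dens * ‖u‖ ^ 2) + (q ^ 2)⁻¹ * ‖u‖ ^ 2 := by
        gcongr
        exact norm_averageOn_univ_sq_le_of_eq_zero hu
    _ = (G.dens + (1 - G.dens) / q ^ 2) * ‖u‖ ^ 2 := by
        ring

theorem sum_norm_sq_le_norm_weight_progressProj_sq {q : ℝ} (hq : 1 ≤ q) (f : L2Fun X V) :
    ∑ v ∈ G, ‖f v‖ ^ 2 ≤
      (G.dens + (1 - G.dens) / q ^ 2) * ‖weight (progressProj G) q f‖ ^ 2 := by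
  set W : ℝ → L2Fun X V →ₗ[ℝ] L2Fun X V := weight (progressProj G)
  set η : ℝ := G.dens + (1 - G.dens) / q ^ 2
  have hη : 0 ≤ η := dens_add_div_sq_nonneg G q
  -- Since `W q⁻¹` is inverse to `W q` and self-adjoint, `‖u‖² = ⟪u, f⟫ = ⟪W q⁻¹ u, W q f⟫`.
  set u : L2Fun X V := WithLp.toLp 2 fun v => if v ∈ G then f v else 0
  have hnorm : ∑ v ∈ G, ‖f v‖ ^ 2 = ‖u‖ ^ 2 := by
    simp [PiLp.norm_sq_eq_of_L2, u, apply_ite, ite_pow]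
  have hinner : ⟪u, f⟫ = ‖u‖ ^ 2 := by
    rw [← real_inner_self_eq_norm_sq, PiLp.inner_apply, PiLp.inner_apply]
    refine Finset.sum_congr rfl fun v _ => ?_
    by_cases hv : v ∈ G <;> simp [u, hv]
  have hCS : ‖u‖ * ‖u‖ ≤ ‖u‖ * (√η * ‖W q f‖) :=
    calc ‖u‖ * ‖u‖ = ⟪W q⁻¹ u, W q f⟫ := by
          rw [inner_weight_inv_weight (isSymmetricProjection_progressProj G) (by positivity),
            hinner, sq]
      _ ≤ ‖W q⁻¹ u‖ * ‖W q f‖ := real_inner_le_norm _ _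
      _ ≤ √η * ‖u‖ * ‖W q f‖ := by
          gcongr
          refine le_of_sq_le_sq ?_ (by positivity)
          rw [mul_pow, Real.sq_sqrt hη]
          exact norm_weight_progressProj_inv_sq_le hq fun v hv => by simp [u, hv]
      _ = ‖u‖ * (√η * ‖W q f‖) := by ring
  rw [hnorm, ← Real.sq_sqrt hη, ← mul_pow]
  gcongr
  rcases (norm_nonneg u).eq_or_lt with hu | hu
  · rw [← hu]
    positivity
  · exact le_of_mul_le_mul_left hCS hu

end SingleVariable

section ManyVariables

variable {E X V V' : Type*} [Fintype E] [DecidableEq E] [Fintype X]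
  [NormedAddCommGroup V] [InnerProductSpace ℝ V] [NormedAddCommGroup V'] [InnerProductSpace ℝ V']

/-- The restriction of a function of many variables to the line through `h` on which only the
variable `e` varies. -/
def slice (e : E) (h : E → X) : L2Fun (E → X) V →ₗ[ℝ] L2Fun X V where
  toFun F := WithLp.toLp 2 fun v => F (Function.update h e v)
  map_add' _ _ := rfl
  map_smul' _ _ := rfl

theorem slice_apply (e : E) (h : E → X) (F : L2Fun (E → X) V) (v : X) :
    slice e h F v = F (Function.update h e v) := rfl

theorem slice_update (e : E) (h : E → X) (v : X) (F : L2Fun (E → X) V) :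
    slice e (Function.update h e v) F = slice e h F := by
  ext w
  simp only [slice_apply, Function.update_idem]

theorem sum_sum_update (e : E) (φ : (E → X) → ℝ) :
    ∑ h, ∑ v, φ (Function.update h e v) = Fintype.card X * ∑ h, φ h := by
  let swap : (E → X) × X ≃ (E → X) × X :=
    { toFun := fun a => (Function.update a.1 e a.2, a.1 e)
      invFun := fun a => (Function.update a.1 e a.2, a.1 e)
      left_inv := fun a => by simp
      right_inv := fun a => by simp }
  calc ∑ h, ∑ v, φ (Function.update h e v)
      = ∑ a : (E → X) × X, φ (Function.update a.1 e a.2) := by rw [Fintype.sum_prod_type]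
    _ = ∑ a : (E → X) × X, φ a.1 := Fintype.sum_equiv swap _ _ fun _ => rfl
    _ = Fintype.card X * ∑ h, φ h := by simp [Fintype.sum_prod_type, Finset.mul_sum]

theorem sum_le_of_sum_update_le (e : E) {φ ψ : (E → X) → ℝ} {C : ℝ}
    (H : ∀ h, ∑ v, φ (Function.update h e v) ≤ C * ∑ v, ψ (Function.update h e v)) :
    ∑ h, φ h ≤ C * ∑ h, ψ h := by
  rcases isEmpty_or_nonempty X with hX | hX
  · have : IsEmpty (E → X) := ⟨fun h => hX.elim (h e)⟩
    simp
  have hcard : (0 : ℝ) < Fintype.card X := by exact_mod_cast Fintype.card_pos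
  refine le_of_mul_le_mul_left ?_ hcard
  rw [← sum_sum_update e, mul_left_comm, ← sum_sum_update e, Finset.mul_sum]
  exact Finset.sum_le_sum fun h _ => H h

theorem norm_sq_le_of_norm_slice_sq_le (e : E) {F : L2Fun (E → X) V} {F' : L2Fun (E → X) V'}
    {C : ℝ} (H : ∀ h, ‖slice e h F‖ ^ 2 ≤ C * ‖slice e h F'‖ ^ 2) :
    ‖F‖ ^ 2 ≤ C * ‖F'‖ ^ 2 := by
  simp only [PiLp.norm_sq_eq_of_L2] at H ⊢
  exact sum_le_of_sum_update_le e H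

/-- The operator that applies to `F h` the linear map selected by the value `h e`. -/
def controlledAt (e : E) (S : X → V →ₗ[ℝ] V) : Module.End ℝ (L2Fun (E → X) V) where
  toFun F := WithLp.toLp 2 fun h => S (h e) (F h)
  map_add' F F' := by
    ext h
    simp
  map_smul' a F := by
    ext h
    simp

theorem controlledAt_apply (e : E) (S : X → V →ₗ[ℝ] V) (F : L2Fun (E → X) V) (h : E → X) :
    controlledAt e S F h = S (h e) (F h) := rfl

variable [DecidableEq X] {G : Finset X}

/-- The operator `weight (progressProj G) q` acting on the variable `e`. -/
noncomputable def entryWeight (G : Finset X) (q : ℝ) (e : E) :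
    Module.End ℝ (L2Fun (E → X) V) where
  toFun F := WithLp.toLp 2 fun h => weight (progressProj G) q (slice e h F) (h e)
  map_add' F F' := by
    ext h
    simp
  map_smul' a F := by
    ext h
    simp

theorem entryWeight_apply (G : Finset X) (q : ℝ) (e : E) (F : L2Fun (E → X) V) (h : E → X) :
    entryWeight G q e F h = weight (progressProj G) q (slice e h F) (h e) := rfl

theorem slice_entryWeight (G : Finset X) (q : ℝ) (e : E) (F : L2Fun (E → X) V) (h : E → X) :
    slice e h (entryWeight G q e F) = weight (progressProj G) q (slice e h F) := by
  ext v
  rw [slice_apply, entryWeight_apply, slice_update, Function.update_self]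

theorem entryWeight_map (L : V →ₗ[ℝ] V') (G : Finset X) (q : ℝ) (e : E) (F : L2Fun (E → X) V)
    (h : E → X) :
    entryWeight G q e (WithLp.toLp 2 fun h => L (F h)) h = L (entryWeight G q e F h) :=
  weight_progressProj_map L G q (slice e h F) (h e)

theorem entryWeight_const (G : Finset X) (q : ℝ) (e : E) (a : V) :
    entryWeight G q e (WithLp.toLp 2 fun _ : E → X => a) = WithLp.toLp 2 fun _ => a := by
  ext h
  exact congr($(weight_progressProj_const G q a) (h e))

theorem commute_entryWeight (G : Finset X) (q : ℝ) {e e' : E} (he : e ≠ e') :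
    Commute (entryWeight (V := V) G q e) (entryWeight G q e') := by
  ext F h
  -- `Φ` is `F` as a function of the two variables; evaluating at `h e'` is a linear map on its
  -- values, with which the weight in the variable `e` commutes.
  let Φ : L2Fun X (L2Fun X V) := WithLp.toLp 2 fun w => slice e' (Function.update h e w) F
  let L : L2Fun X V →ₗ[ℝ] V :=
    PiLp.projₗ 2 (𝕜 := ℝ) (fun _ : X => V) (h e') ∘ₗ weight (progressProj G) q
  have hslice : slice e h (entryWeight G q e' F) = WithLp.toLp 2 fun w => L (Φ w) := by
    ext w
    simp [slice_apply, entryWeight_apply, L, Φ, he.symm]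
  have hΦ : slice e' h (entryWeight G q e F) = weight (progressProj G) q Φ (h e) := by
    ext w'
    have hΦw' : slice e (Function.update h e' w') F =
        WithLp.toLp 2 fun w => PiLp.projₗ 2 (𝕜 := ℝ) (fun _ : X => V) w' (Φ w) := by
      ext w
      simp [slice_apply, Φ, Function.update_comm he]
    rw [slice_apply, entryWeight_apply, hΦw', weight_progressProj_map, Function.update_of_ne he]
    rfl
  calc entryWeight G q e (entryWeight G q e' F) h
      = weight (progressProj G) q (WithLp.toLp 2 fun w => L (Φ w)) (h e) := by
        rw [entryWeight_apply, hslice]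
    _ = L (weight (progressProj G) q Φ (h e)) := weight_progressProj_map L G q Φ (h e)
    _ = entryWeight G q e' (entryWeight G q e F) h := by
        rw [entryWeight_apply G q e', hΦ]
        rfl

theorem commute_controlledAt_entryWeight (G : Finset X) (q : ℝ) {e e' : E} (he : e' ≠ e)
    (S : X → V →ₗ[ℝ] V) : Commute (controlledAt e S) (entryWeight G q e') := by
  ext F h
  have hslice : slice e' h (controlledAt e S F) =
      WithLp.toLp 2 fun w => S (h e) (slice e' h F w) := by
    ext w
    simp [slice_apply, controlledAt_apply, he.symm]
  simp only [Module.End.mul_apply, controlledAt_apply, entryWeight_apply, hslice,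
    weight_progressProj_map]

theorem pairwise_commute_entryWeight (G : Finset X) (q : ℝ) (s : Finset E) :
    (s : Set E).Pairwise (Function.onFun Commute (entryWeight (V := V) G q)) :=
  fun _ _ _ _ hne => commute_entryWeight G q hne

/-- The operator `weight (progressProj G) q` acting on all the variables in `s`. -/
noncomputable def weightOn (G : Finset X) (q : ℝ) (s : Finset E) :
    Module.End ℝ (L2Fun (E → X) V) :=
  s.noncommProd (entryWeight G q) (pairwise_commute_entryWeight G q s)

theorem weightOn_empty (G : Finset X) (q : ℝ) (F : L2Fun (E → X) V) : weightOn G q ∅ F = F := by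
  rw [weightOn, Finset.noncommProd_empty, Module.End.one_apply]

theorem weightOn_insert (G : Finset X) (q : ℝ) {s : Finset E} {e : E} (he : e ∉ s)
    (F : L2Fun (E → X) V) :
    weightOn G q (insert e s) F = entryWeight G q e (weightOn G q s F) := by
  rw [weightOn, Finset.noncommProd_insert_of_notMem _ _ _ _ he, Module.End.mul_apply, weightOn]

theorem weightOn_controlledAt (G : Finset X) (q : ℝ) {s : Finset E} {e : E} (he : e ∉ s)
    (S : X → V →ₗ[ℝ] V) (F : L2Fun (E → X) V) :
    weightOn G q s (controlledAt e S F) = controlledAt e S (weightOn G q s F) := by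
  have h : Commute (controlledAt e S) (weightOn G q s) :=
    Finset.noncommProd_commute _ _ _ _ fun e' he' =>
      commute_controlledAt_entryWeight G q (ne_of_mem_of_not_mem he' he) S
  exact congr($(h.eq.symm) F)

theorem weightOn_map (L : V →ₗ[ℝ] V') (G : Finset X) (q : ℝ) (s : Finset E) (F : L2Fun (E → X) V) :
    weightOn G q s (WithLp.toLp 2 fun h => L (F h)) =
      WithLp.toLp 2 fun h => L (weightOn G q s F h) := by
  induction s using Finset.induction_on with
  | empty => simp only [weightOn_empty]
  | insert e s he ih =>
    ext h
    rw [weightOn_insert G q he, weightOn_insert G q he, ih, entryWeight_map]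

theorem weightOn_const (G : Finset X) (q : ℝ) (s : Finset E) (a : V) :
    weightOn G q s (WithLp.toLp 2 fun _ : E → X => a) = WithLp.toLp 2 fun _ => a := by
  induction s using Finset.induction_on with
  | empty => rw [weightOn_empty]
  | insert e s he ih => rw [weightOn_insert G q he, ih, entryWeight_const]

theorem norm_weightOn_map_sq {L : V →ₗ[ℝ] V'} (hL : ∀ a, ‖L a‖ = ‖a‖) (G : Finset X) (q : ℝ)
    (s : Finset E) (F : L2Fun (E → X) V) :
    ‖weightOn G q s (WithLp.toLp 2 fun h => L (F h))‖ ^ 2 = ‖weightOn G q s F‖ ^ 2 := by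
  simp only [weightOn_map, PiLp.norm_sq_eq_of_L2, hL]

theorem norm_weightOn_sq_eq_sum_map {ι : Type*} [Fintype ι] {L : ι → V →ₗ[ℝ] V'}
    (hL : ∀ a, ‖a‖ ^ 2 = ∑ j, ‖L j a‖ ^ 2) (G : Finset X) (q : ℝ) (s : Finset E)
    (F : L2Fun (E → X) V) :
    ‖weightOn G q s F‖ ^ 2 =
      ∑ j, ‖weightOn G q s (WithLp.toLp 2 fun h => L j (F h))‖ ^ 2 := by
  simp only [weightOn_map, PiLp.norm_sq_eq_of_L2, hL]
  exact Finset.sum_comm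

theorem norm_sq_le_norm_entryWeight_sq {q : ℝ} (hq : 1 ≤ q) (e : E) (F : L2Fun (E → X) V) :
    ‖F‖ ^ 2 ≤ ‖entryWeight G q e F‖ ^ 2 := by
  rw [← one_mul (‖entryWeight G q e F‖ ^ 2)]
  refine norm_sq_le_of_norm_slice_sq_le e fun h => ?_
  rw [one_mul, slice_entryWeight]
  exact norm_sq_le_norm_weight_sq (isSymmetricProjection_progressProj G) hq _

theorem norm_weightOn_sq_mono {q : ℝ} (hq : 1 ≤ q) {s t : Finset E} (hst : s ⊆ t)
    (F : L2Fun (E → X) V) : ‖weightOn G q s F‖ ^ 2 ≤ ‖weightOn G q t F‖ ^ 2 := by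
  have hunion (r : Finset E) : ‖weightOn G q s F‖ ^ 2 ≤ ‖weightOn G q (r ∪ s) F‖ ^ 2 := by
    induction r using Finset.induction_on with
    | empty => rw [Finset.empty_union]
    | insert e r _ ih =>
      rw [Finset.insert_union]
      by_cases he : e ∈ r ∪ s
      · rwa [Finset.insert_eq_of_mem he]
      · rw [weightOn_insert G q he]
        exact ih.trans (norm_sq_le_norm_entryWeight_sq hq e _)
  simpa only [Finset.union_eq_left.mpr hst] using hunion t

theorem norm_weightOn_univ_controlledAt_sq_le (hG : G ≠ univ) {q : ℝ} (hq : 1 ≤ q) (e : E)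
    {S : X → V ≃ₗᵢ[ℝ] V} (hS : ∀ w a, S w (∑ v, S v a) = ∑ v, S v a) (F : L2Fun (E → X) V) :
    ‖weightOn G q univ (controlledAt e (fun v => S v) F)‖ ^ 2 ≤
      Real.exp (q * √(2 * G.dens / (1 - G.dens))) * ‖weightOn G q univ F‖ ^ 2 := by
  have he := Finset.notMem_erase e univ
  rw [← Finset.insert_erase (Finset.mem_univ e), weightOn_insert G q he, weightOn_insert G q he,
    weightOn_controlledAt G q he]
  generalize weightOn G q (univ.erase e) F = F'
  refine norm_sq_le_of_norm_slice_sq_le e fun h => ?_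
  have hslice : slice e h (controlledAt e (fun v => (S v : V →ₗ[ℝ] V)) F') =
      LinearIsometryEquiv.piLpCongrRight 2 S (slice e h F') := by
    ext v
    simp [slice_apply, controlledAt_apply]
  rw [slice_entryWeight, slice_entryWeight, hslice]
  exact norm_weight_map_sq_le (isSymmetricProjection_progressProj G) hq (Real.sqrt_nonneg _)
    (LinearIsometryEquiv.piLpCongrRight 2 S).toLinearIsometry
    (fun _ => norm_progressProj_controlled_le hG hS) (slice e h F')

theorem sum_mem_norm_sq_le_norm_entryWeight_sq {q : ℝ} (hq : 1 ≤ q) (e : E)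
    (F : L2Fun (E → X) V) :
    ∑ h with h e ∈ G, ‖F h‖ ^ 2 ≤
      (G.dens + (1 - G.dens) / q ^ 2) * ‖entryWeight G q e F‖ ^ 2 := by
  rw [Finset.sum_filter, PiLp.norm_sq_eq_of_L2]
  refine sum_le_of_sum_update_le e fun h => ?_
  have hslice := sum_norm_sq_le_norm_weight_progressProj_sq (G := G) hq (slice e h F)
  rw [← slice_entryWeight, PiLp.norm_sq_eq_of_L2] at hslice
  simpa [← Finset.sum_filter, slice_apply] using hslice

end ManyVariables

section Chains

variable {E X Y V : Type*} [Fintype E] [DecidableEq E] [Fintype X] [DecidableEq X]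
  [NormedAddCommGroup V] [InnerProductSpace ℝ V] {G : Finset X}

theorem norm_controlledAt_single_sq (e : E) (x : X) (F : L2Fun (E → X) V) (h : E → X) :
    ‖controlledAt e (Pi.single x LinearMap.id) F h‖ ^ 2 = if h e = x then ‖F h‖ ^ 2 else 0 := by
  by_cases hx : h e = x <;> simp [controlledAt_apply, hx]

theorem sum_norm_controlledAt_single_sq (G : Finset X) (e : E) (F : L2Fun (E → X) V) :
    ∑ x ∈ G, ‖controlledAt e (Pi.single x LinearMap.id) F‖ ^ 2 =
      ∑ h with h e ∈ G, ‖F h‖ ^ 2 := by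
  simp only [PiLp.norm_sq_eq_of_L2, norm_controlledAt_single_sq]
  rw [Finset.sum_comm, Finset.sum_filter]
  exact Finset.sum_congr rfl fun h _ => Finset.sum_ite_eq G (h e) fun _ => ‖F h‖ ^ 2

variable {N : ℕ}

/-- `ChainFrom G h i x ys` says that `ys` is a chain with all values in `G` which starts from `x`
and whose first query is to the oracle of index `i`, the oracles being encoded as one function of
the entries `(i, x, y)`. -/
def ChainFrom (G : Finset X) (h : Fin N × X × Y → X) : ℕ → X → List Y → Prop
  | _, _, [] => True
  | i, x, y :: ys => ∃ hi : i < N,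
      h (⟨i, hi⟩, x, y) ∈ G ∧ ChainFrom G h (i + 1) (h (⟨i, hi⟩, x, y)) ys

variable [Fintype Y] [DecidableEq Y] {q : ℝ}

open Classical in
theorem sum_chainFrom_cons_norm_sq {i : ℕ} (hi : i < N) (x : X) (y : Y) (ys : List Y)
    (F : L2Fun (Fin N × X × Y → X) V) :
    ∑ h with ChainFrom G h i x (y :: ys), ‖F h‖ ^ 2 =
      ∑ x' ∈ G, ∑ h with ChainFrom G h (i + 1) x' ys,
        ‖controlledAt (⟨i, hi⟩, x, y) (Pi.single x' LinearMap.id) F h‖ ^ 2 := by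
  simp only [Finset.sum_filter, norm_controlledAt_single_sq, ← ite_and]
  rw [Finset.sum_comm]
  refine Finset.sum_congr rfl fun h _ => ?_
  simp only [and_comm (a := ChainFrom ..), ite_and, Finset.sum_ite_eq, ChainFrom, hi,
    exists_true_left]

open Classical in
theorem sum_chainFrom_norm_sq_le (hq : 1 ≤ q) (ys : List Y) (i : ℕ) (x : X)
    (F : L2Fun (Fin N × X × Y → X) V) :
    ∑ h with ChainFrom G h i x ys, ‖F h‖ ^ 2 ≤
      (G.dens + (1 - G.dens) / q ^ 2) ^ ys.length * ‖weightOn G q {e | i ≤ e.1} F‖ ^ 2 := by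
  have hη := dens_add_div_sq_nonneg G q
  induction ys generalizing i x F with
  | nil =>
    have hmono := norm_weightOn_sq_mono (G := G) hq (Finset.empty_subset {e | i ≤ e.1}) F
    rw [Finset.filter_true_of_mem fun _ _ => by trivial, ← PiLp.norm_sq_eq_of_L2]
    simpa only [weightOn_empty, List.length_nil, pow_zero, one_mul] using hmono
  | cons y ys ih =>
    by_cases hi : i < N
    swap
    · simp only [ChainFrom, hi, IsEmpty.exists_iff, Finset.filter_false, Finset.sum_empty]
      positivity
    let e : Fin N × X × Y := (⟨i, hi⟩, x, y)
    let later : Finset (Fin N × X × Y) := {e | i + 1 ≤ e.1}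
    have he : e ∉ later := by simp [later, e]
    have hsubset : insert e later ⊆ ({e | i ≤ e.1} : Finset (Fin N × X × Y)) :=
      Finset.insert_subset (by simp [e])
        (Finset.monotone_filter_right _ fun _ _ => Nat.le_of_succ_le)
    set η : ℝ := G.dens + (1 - G.dens) / q ^ 2
    calc ∑ h with ChainFrom G h i x (y :: ys), ‖F h‖ ^ 2
        = ∑ x' ∈ G, ∑ h with ChainFrom G h (i + 1) x' ys,
            ‖controlledAt e (Pi.single x' LinearMap.id) F h‖ ^ 2 :=
          sum_chainFrom_cons_norm_sq hi x y ys F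
      _ ≤ ∑ x' ∈ G, η ^ ys.length *
            ‖controlledAt e (Pi.single x' LinearMap.id) (weightOn G q later F)‖ ^ 2 := by
          refine Finset.sum_le_sum fun x' _ => ?_
          rw [← weightOn_controlledAt G q he]
          exact ih (i + 1) x' _
      _ = η ^ ys.length * ∑ h with h e ∈ G, ‖weightOn G q later F h‖ ^ 2 := by
          rw [← Finset.mul_sum, sum_norm_controlledAt_single_sq]
      _ ≤ η ^ ys.length * (η * ‖weightOn G q (insert e later) F‖ ^ 2) := by
          rw [weightOn_insert G q he]
          gcongr
          exact sum_mem_norm_sq_le_norm_entryWeight_sq hq e _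
      _ ≤ η ^ (ys.length + 1) * ‖weightOn G q {e | i ≤ e.1} F‖ ^ 2 := by
          rw [← mul_assoc, ← pow_succ]
          gcongr ?_ * ?_
          exact norm_weightOn_sq_mono hq hsubset F

end Chains

section Adversaries

variable {κ N : ℕ} {Y W : Type*}

/-- The set of the hash values that are proofs of work, i.e. at most `T`. -/
def powSet (κ T : ℕ) : Finset (Hash κ) := {v | v.toNat ≤ T}

theorem dens_powSet (κ T : ℕ) : ((powSet κ T).dens : ℝ) = powProb κ T :=
  Finset.nnratCast_dens _

theorem powProb_pos (κ T : ℕ) : 0 < powProb κ T := by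
  have hzero : (fun _ => false) ∈ powSet κ T :=
    (Finset.mem_filter_univ _).mpr (by simp [Hash.toNat])
  rw [← dens_powSet]
  exact_mod_cast Finset.dens_pos.mpr ⟨_, hzero⟩

theorem powSet_ne_univ {T : ℕ} (hT : powProb κ T < 1) : powSet κ T ≠ univ := by
  intro huniv
  rw [← dens_powSet, huniv, Finset.dens_univ, NNRat.cast_one] at hT
  exact lt_irrefl _ hT

theorem IsPoWChain.chainFrom {h : Fin N × Hash κ × Y → Hash κ} {T : ℕ} {x₀ : Hash κ} {ys : List Y}
    (H : IsPoWChain (Function.curry h) T x₀ ys) : ChainFrom (powSet κ T) h 0 x₀ ys := by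
  obtain ⟨hl, x, rfl, hx⟩ := H
  suffices hdrop : ∀ i (hi : i ≤ ys.length),
      ChainFrom (powSet κ T) h i (x ⟨i, Nat.lt_succ_of_le hi⟩) (ys.drop i) from
    hdrop 0 (Nat.zero_le _)
  intro i hi
  induction hi using Nat.decreasingInduction with
  | self =>
    rw [List.drop_length]
    trivial
  | of_succ i hi ih =>
    obtain ⟨hval, hle⟩ := hx ⟨i, hi⟩
    rw [List.drop_eq_getElem_cons hi]
    refine ⟨hi.trans_le hl, ?_⟩
    have hval' : x ⟨i + 1, Nat.succ_lt_succ hi⟩ = h (⟨i, hi.trans_le hl⟩, x ⟨i, _⟩, ys[i]) := hval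
    rw [← hval']
    exact ⟨by simpa [powSet] using hle, ih⟩

variable [Fintype Y] [Fintype W]

theorem norm_applyQuery (h : Oracle κ N Y) (ψ : EuclideanSpace ℂ (Label κ N Y W)) :
    ‖applyQuery h ψ‖ = ‖ψ‖ :=
  (LinearIsometryEquiv.piLpCongrLeft 2 ℂ ℂ (queryPerm W h)).norm_map ψ

theorem Adversary.norm_state (A : Adversary κ N Y W) (h : Oracle κ N Y) (t : ℕ) :
    ‖A.state h t‖ = 1 := by
  induction t with
  | zero => rw [Adversary.state, LinearIsometryEquiv.norm_map, A.norm_init]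
  | succ t ih => rw [Adversary.state, LinearIsometryEquiv.norm_map, norm_applyQuery, ih]

theorem Adversary.successProbFor_le_one (A : Adversary κ N Y W) (t T : ℕ) (x₀ : Hash κ) (k : ℕ)
    (h : Oracle κ N Y) : A.successProbFor t T x₀ k h ≤ 1 := by
  rw [Adversary.successProbFor, ← one_pow 2, ← A.norm_state h t, EuclideanSpace.norm_sq_eq]
  gcongr
  split_ifs
  · exact le_rfl
  · positivity

theorem Adversary.successProb_le_one (A : Adversary κ N Y W) (t T : ℕ) (x₀ : Hash κ) (k : ℕ) :
    A.successProb t T x₀ k ≤ 1 := by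
  rw [Adversary.successProb]
  exact div_le_one_of_le₀ ((Finset.sum_le_card_nsmul _ _ 1 fun h _ =>
    A.successProbFor_le_one t T x₀ k h).trans_eq (nsmul_one _)) (Nat.cast_nonneg _)

theorem Adversary.successProb_eq_zero_of_lt (A : Adversary κ N Y W) (t T : ℕ) (x₀ : Hash κ) {k : ℕ}
    (hk : N < k) : A.successProb t T x₀ k = 0 := by
  rw [Adversary.successProb, Finset.sum_eq_zero, zero_div]
  refine fun h _ => Finset.sum_eq_zero fun b _ => if_neg ?_
  rintro ⟨hlen, hlen', -⟩
  omega

open Classical in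
theorem Adversary.successProb_eq (A : Adversary κ N Y W) (t T : ℕ) (x₀ : Hash κ) (k : ℕ) :
    A.successProb t T x₀ k =
      (∑ h : Fin N × Hash κ × Y → Hash κ, A.successProbFor t T x₀ k (Function.curry h)) /
        Fintype.card (Fin N × Hash κ × Y → Hash κ) := by
  rw [Adversary.successProb, Fintype.card_congr (Equiv.curry (Fin N) (Hash κ × Y) (Hash κ)),
    ← (Equiv.curry (Fin N) (Hash κ × Y) (Hash κ)).sum_comp]
  rfl

/-- The part of a state in which the query registers hold the entry `e`. -/
def component (e : Fin N × Hash κ × Y) :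
    EuclideanSpace ℂ (Label κ N Y W) →ₗ[ℝ] EuclideanSpace ℂ (Hash κ × W) where
  toFun ψ := WithLp.toLp 2 fun a => ψ (e.1, e.2.1, e.2.2, a.1, a.2)
  map_add' _ _ := rfl
  map_smul' _ _ := rfl

theorem norm_sq_eq_sum_norm_component_sq (ψ : EuclideanSpace ℂ (Label κ N Y W)) :
    ‖ψ‖ ^ 2 = ∑ e, ‖component e ψ‖ ^ 2 := by
  simp only [EuclideanSpace.norm_sq_eq, Fintype.sum_prod_type]
  rfl

/-- The permutation `z ↦ z ⊕ v` of the hash values. -/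
def xorPerm (v : Hash κ) : Equiv.Perm (Hash κ) :=
  Function.Involutive.toPerm (Hash.xor · v) fun z => z.xor_xor_cancel v

/-- The isometry `|z, w⟩ ↦ |z ⊕ v, w⟩` of the states of the response register and workspace. -/
noncomputable def xorIsometry (W : Type*) [Fintype W] (v : Hash κ) :
    EuclideanSpace ℂ (Hash κ × W) ≃ₗᵢ[ℝ] EuclideanSpace ℂ (Hash κ × W) :=
  LinearIsometryEquiv.piLpCongrLeft 2 ℝ ℂ ((xorPerm v).prodCongr (Equiv.refl W))

theorem xorIsometry_xorIsometry (v w : Hash κ) (ψ : EuclideanSpace ℂ (Hash κ × W)) :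
    xorIsometry W w (xorIsometry W v ψ) = xorIsometry W (xorPerm w v) ψ := by
  ext a
  have hxor : (a.1.xor w).xor v = a.1.xor (v.xor w) := by
    funext i
    simp [Hash.xor, Bool.xor_comm (v i)]
  exact congr(ψ ($hxor, a.2))

theorem xorIsometry_sum_xorIsometry (w : Hash κ) (ψ : EuclideanSpace ℂ (Hash κ × W)) :
    xorIsometry W w (∑ v, xorIsometry W v ψ) = ∑ v, xorIsometry W v ψ := by
  simp only [map_sum, xorIsometry_xorIsometry]
  exact Equiv.sum_comp (xorPerm w) fun v => xorIsometry W v ψ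

theorem component_applyQuery (h : Fin N × Hash κ × Y → Hash κ) (e : Fin N × Hash κ × Y)
    (ψ : EuclideanSpace ℂ (Label κ N Y W)) :
    component e (applyQuery (Function.curry h) ψ) = xorIsometry W (h e) (component e ψ) := rfl

variable [DecidableEq Y] {G : Finset (Hash κ)} {q : ℝ}

theorem norm_weightOn_univ_applyQuery_sq_le (hG : G ≠ univ) (hq : 1 ≤ q)
    (F : L2Fun (Fin N × Hash κ × Y → Hash κ) (EuclideanSpace ℂ (Label κ N Y W))) :
    ‖weightOn G q univ (WithLp.toLp 2 fun h => applyQuery (Function.curry h) (F h))‖ ^ 2 ≤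
      Real.exp (q * √(2 * G.dens / (1 - G.dens))) * ‖weightOn G q univ F‖ ^ 2 := by
  rw [norm_weightOn_sq_eq_sum_map (L := component) norm_sq_eq_sum_norm_component_sq,
    norm_weightOn_sq_eq_sum_map (L := component) norm_sq_eq_sum_norm_component_sq G q univ F,
    Finset.mul_sum]
  gcongr with e
  have hquery : WithLp.toLp 2 (fun h => component e (applyQuery (Function.curry h) (F h))) =
      controlledAt e (fun v => xorIsometry W v) (WithLp.toLp 2 fun h => component e (F h)) := by
    simp only [component_applyQuery]
    rfl
  rw [hquery]
  exact norm_weightOn_univ_controlledAt_sq_le hG hq e xorIsometry_sum_xorIsometry _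

/-- The states after `t` queries, as a function of the oracles; these are encoded as one function
of the entries `(i, x, y)`. -/
noncomputable def Adversary.jointState (A : Adversary κ N Y W) (t : ℕ) :
    L2Fun (Fin N × Hash κ × Y → Hash κ) (EuclideanSpace ℂ (Label κ N Y W)) :=
  WithLp.toLp 2 fun h => A.state (Function.curry h) t

theorem Adversary.norm_weightOn_univ_jointState_sq_le (A : Adversary κ N Y W) (hG : G ≠ univ)
    (hq : 1 ≤ q) (t : ℕ) :
    ‖weightOn G q univ (A.jointState t)‖ ^ 2 ≤
      Real.exp (q * √(2 * G.dens / (1 - G.dens))) ^ t *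
        Fintype.card (Fin N × Hash κ × Y → Hash κ) := by
  induction t with
  | zero =>
    simp only [Adversary.jointState, Adversary.state, weightOn_const,
      PiLp.norm_sq_eq_of_L2 (fun _ : Fin N × Hash κ × Y → Hash κ => _),
      LinearIsometryEquiv.norm_map, A.norm_init]
    simp
  | succ t ih =>
    let F : L2Fun (Fin N × Hash κ × Y → Hash κ) (EuclideanSpace ℂ (Label κ N Y W)) :=
      WithLp.toLp 2 fun h => applyQuery (Function.curry h) (A.jointState t h)
    set C := Real.exp (q * √(2 * G.dens / (1 - G.dens)))
    calc ‖weightOn G q univ (A.jointState (t + 1))‖ ^ 2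
        = ‖weightOn G q univ F‖ ^ 2 :=
          norm_weightOn_map_sq (L := (A.U (t + 1)).toLinearEquiv.toLinearMap.restrictScalars ℝ)
            (A.U (t + 1)).norm_map G q univ F
      _ ≤ C * ‖weightOn G q univ (A.jointState t)‖ ^ 2 :=
          norm_weightOn_univ_applyQuery_sq_le hG hq _
      _ ≤ C * (C ^ t * Fintype.card (Fin N × Hash κ × Y → Hash κ)) := by gcongr
      _ = C ^ (t + 1) * Fintype.card (Fin N × Hash κ × Y → Hash κ) := by
          rw [← mul_assoc, ← pow_succ']

open Classical in
theorem Adversary.sum_isPoWChain_norm_sq_le (A : Adversary κ N Y W) (hq : 1 ≤ q) (t T : ℕ)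
    (x₀ : Hash κ) (k : ℕ) (b : Label κ N Y W) :
    ∑ h with k ≤ (A.out b).length ∧ IsPoWChain (Function.curry h) T x₀ (A.out b),
        ‖A.jointState t h b‖ ^ 2 ≤
      (powProb κ T + (1 - powProb κ T) / q ^ 2) ^ k *
        ‖weightOn (powSet κ T) q univ (WithLp.toLp 2 fun h => A.jointState t h b)‖ ^ 2 := by
  let F : L2Fun (Fin N × Hash κ × Y → Hash κ) ℂ := WithLp.toLp 2 fun h => A.jointState t h b
  have hη := dens_add_div_sq_nonneg (powSet κ T) q
  have hη1 := dens_add_div_sq_le_one (powSet κ T) hq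
  have hchain := sum_chainFrom_norm_sq_le (G := powSet κ T) hq (A.out b) 0 x₀ F
  simp only [Nat.zero_le, Finset.filter_true, dens_powSet] at hη hη1 hchain
  by_cases hk : k ≤ (A.out b).length
  · simp only [hk, true_and]
    calc ∑ h with IsPoWChain (Function.curry h) T x₀ (A.out b), ‖F h‖ ^ 2
        ≤ ∑ h with ChainFrom (powSet κ T) h 0 x₀ (A.out b), ‖F h‖ ^ 2 :=
          Finset.sum_le_sum_of_subset_of_nonneg
            (Finset.monotone_filter_right _ fun h _ => IsPoWChain.chainFrom)
            fun _ _ _ => sq_nonneg _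
      _ ≤ _ := hchain
      _ ≤ _ := by gcongr ?_ * _; exact pow_le_pow_of_le_one hη hη1 hk
  · simp only [hk, false_and, Finset.filter_false, Finset.sum_empty]
    positivity

theorem Adversary.sum_successProbFor_le (A : Adversary κ N Y W) (hq : 1 ≤ q) (t T : ℕ)
    (x₀ : Hash κ) (k : ℕ) :
    ∑ h : Fin N × Hash κ × Y → Hash κ, A.successProbFor t T x₀ k (Function.curry h) ≤
      (powProb κ T + (1 - powProb κ T) / q ^ 2) ^ k *
        ‖weightOn (powSet κ T) q univ (A.jointState t)‖ ^ 2 := by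
  classical
  simp only [Adversary.successProbFor]
  rw [Finset.sum_comm, norm_weightOn_sq_eq_sum_map
    (L := fun b => PiLp.projₗ 2 (𝕜 := ℝ) (fun _ : Label κ N Y W => ℂ) b)
    EuclideanSpace.norm_sq_eq, Finset.mul_sum]
  gcongr with b
  rw [← Finset.sum_filter]
  exact A.sum_isPoWChain_norm_sq_le hq t T x₀ k b

omit [DecidableEq Y] in
theorem Adversary.successProb_le (A : Adversary κ N Y W) {T : ℕ} (hT : powProb κ T < 1)
    (hq : 1 ≤ q) (t : ℕ) (x₀ : Hash κ) (k : ℕ) :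
    A.successProb t T x₀ k ≤ (powProb κ T + (1 - powProb κ T) / q ^ 2) ^ k *
      Real.exp (q * √(2 * powProb κ T / (1 - powProb κ T))) ^ t := by
  classical
  have hη := dens_add_div_sq_nonneg (powSet κ T) q
  have hstate := A.norm_weightOn_univ_jointState_sq_le (powSet_ne_univ hT) hq t
  rw [dens_powSet] at hη hstate
  rw [A.successProb_eq, div_le_iff₀ (by positivity), mul_assoc]
  refine (A.sum_successProbFor_le hq t T x₀ k).trans ?_
  gcongr

end Adversaries

section Bound

variable {N k : ℕ} {p : ℝ}

/-- The bound on the probability of finding a chain of length `k` with `N` queries, as a function of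
the probability `p` that a single evaluation gives a proof of work. -/
noncomputable def chainBound (N k : ℕ) (p : ℝ) : ℝ :=
  2 * (1 - p) / (Real.pi * k) * (((N : ℝ) + k) * Real.exp 1 * √p / k) ^ (2 * k)

theorem chainBound_nonneg (hp : p ≤ 1) : 0 ≤ chainBound N k p := by
  have := sub_nonneg.mpr hp
  rw [chainBound, pow_mul]
  positivity

theorem chainBound_eq (hk : k ≠ 0) (hp : 0 ≤ p) :
    chainBound N k p =
      2 * (1 - p) / (Real.pi * k) * ((N / k + 1 : ℝ) ^ 2 * Real.exp 1 ^ 2 * p) ^ k := by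
  rw [chainBound, pow_mul, div_pow, mul_pow, mul_pow, Real.sq_sqrt hp]
  field_simp

theorem lt_exp_one_sq : (7.38 : ℝ) < Real.exp 1 ^ 2 := by
  have := Real.exp_one_gt_d9
  nlinarith

theorem mul_natCast_le_pow {a : ℝ} (ha : 2 ≤ a) : a * k ≤ a ^ k := by
  cases k with
  | zero => simp
  | succ j =>
    have hj : ((j + 1 : ℕ) : ℝ) ≤ 2 ^ j := by exact_mod_cast Nat.lt_two_pow_self
    rw [pow_succ']
    gcongr
    exact hj.trans (by gcongr)

theorem one_le_chainBound (hk : k ≠ 0) (hp : 0 ≤ p) (hp1 : p ≤ 1)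
    (h : 2 ≤ (1 - p) * ((N / k + 1 : ℝ) ^ 2 * Real.exp 1 ^ 2 * p)) : 1 ≤ chainBound N k p := by
  rw [chainBound_eq hk hp]
  set a := (N / k + 1 : ℝ) ^ 2 * Real.exp 1 ^ 2 * p
  have := sub_nonneg.mpr hp1
  have ha0 : 0 ≤ a := by positivity
  have ha : 2 ≤ a := h.trans (mul_le_of_le_one_left ha0 (by linarith))
  calc (1 : ℝ) ≤ 2 * (1 - p) / (Real.pi * k) * (a * k) := by
        rw [div_mul_eq_mul_div, one_le_div (by positivity)]
        nlinarith [Real.pi_le_four]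
    _ ≤ 2 * (1 - p) / (Real.pi * k) * a ^ k := by
        gcongr
        exact mul_natCast_le_pow ha

theorem one_le_chainBound_of_one_fifth_le (hk : k ≠ 0) (hkN : k ≤ N) (hp : 1 / 5 ≤ p)
    (hp1 : p ≤ 3 / 4) : 1 ≤ chainBound N k p := by
  refine one_le_chainBound hk (by linarith) (by linarith) ?_
  have hm : (1 : ℝ) ≤ N / k := (one_le_div (by positivity)).mpr (by exact_mod_cast hkN)
  calc (2 : ℝ) ≤ (1 - p) * (4 * 7.38 * p) := by nlinarith
    _ ≤ (1 - p) * ((N / k + 1 : ℝ) ^ 2 * Real.exp 1 ^ 2 * p) := by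
        have h1p : 0 ≤ 1 - p := by linarith
        have := lt_exp_one_sq.le
        gcongr
        nlinarith

theorem one_le_chainBound_of_two_lt (hk : k ≠ 0) (hp : 0 ≤ p) (hp1 : p ≤ 1 / 5)
    (h : 2 < √(2 * p / (1 - p)) * (N / k)) : 1 ≤ chainBound N k p := by
  have h1p : 4 / 5 ≤ 1 - p := by linarith
  refine one_le_chainBound hk hp (by linarith) ?_
  have hsq : 2 * (1 - p) ≤ (N / k : ℝ) ^ 2 * p := by
    have h4 : (2 : ℝ) ^ 2 ≤ (√(2 * p / (1 - p)) * (N / k)) ^ 2 := by gcongr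
    rw [mul_pow, Real.sq_sqrt (by positivity), div_mul_eq_mul_div, le_div_iff₀ (by positivity)]
      at h4
    linarith
  calc (2 : ℝ) ≤ (1 - p) * (7.38 * (2 * (1 - p))) := by nlinarith
    _ ≤ (1 - p) * (Real.exp 1 ^ 2 * ((N / k : ℝ) ^ 2 * p)) := by
        have := lt_exp_one_sq.le
        gcongr
    _ = (1 - p) * ((N / k : ℝ) ^ 2 * Real.exp 1 ^ 2 * p) := by ring
    _ ≤ (1 - p) * ((N / k + 1 : ℝ) ^ 2 * Real.exp 1 ^ 2 * p) := by
        gcongr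
        linarith

theorem pi_mul_le_two_pow (k : ℕ) : Real.pi * k ≤ 8 / 5 * 2 ^ k := by
  induction k with
  | zero => norm_num
  | succ k ih =>
    rcases Nat.eq_zero_or_pos k with rfl | hk
    · norm_num
      linarith [Real.pi_lt_d2]
    · have hk' : (1 : ℝ) ≤ k := by exact_mod_cast hk
      push_cast
      rw [pow_succ]
      nlinarith [Real.pi_pos]

theorem pow_le_chainBound (hk : k ≠ 0) (hkN : k ≤ N) (hp : 0 ≤ p) (hp1 : p ≤ 1 / 5) :
    (p * (1 + (N / k) ^ 2 / 2) * Real.exp 1 ^ 2) ^ k ≤ chainBound N k p := by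
  have hm : (1 : ℝ) ≤ N / k := (one_le_div (by positivity)).mpr (by exact_mod_cast hkN)
  have hhalf : (2⁻¹ : ℝ) ^ k ≤ 2 * (1 - p) / (Real.pi * k) := by
    rw [inv_pow, inv_eq_one_div, div_le_div_iff₀ (by positivity) (by positivity), one_mul]
    refine (pi_mul_le_two_pow k).trans ?_
    gcongr
    linarith
  rw [chainBound_eq hk hp]
  calc (p * (1 + (N / k) ^ 2 / 2) * Real.exp 1 ^ 2) ^ k
      ≤ (p * (2⁻¹ * (N / k + 1) ^ 2) * Real.exp 1 ^ 2) ^ k := by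
        gcongr
        nlinarith
    _ = 2⁻¹ ^ k * ((N / k + 1) ^ 2 * Real.exp 1 ^ 2 * p) ^ k := by
        rw [← mul_pow]
        ring
    _ ≤ _ := by gcongr

theorem pow_mul_exp_pow_eq (hk : k ≠ 0) (hN : N ≠ 0) (hp : 0 < p) (hp1 : p < 1) {q : ℝ}
    (hq : q = 2 / (√(2 * p / (1 - p)) * (N / k))) :
    (p + (1 - p) / q ^ 2) ^ k * Real.exp (q * √(2 * p / (1 - p))) ^ N =
      (p * (1 + (N / k) ^ 2 / 2) * Real.exp 1 ^ 2) ^ k := by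
  have h1p : 0 < 1 - p := sub_pos.mpr hp1
  have : 0 < √(2 * p / (1 - p)) := by positivity
  have hcsq : √(2 * p / (1 - p)) ^ 2 = 2 * p / (1 - p) := Real.sq_sqrt (by positivity)
  have hexp : Real.exp (q * √(2 * p / (1 - p))) ^ N = (Real.exp 1 ^ 2) ^ k := by
    simp only [← Real.exp_nat_mul]
    rw [hq]
    congr 1
    push_cast
    field_simp
  have hbase : p + (1 - p) / q ^ 2 = p * (1 + (N / k) ^ 2 / 2) := by
    rw [hq, div_pow, mul_pow, hcsq]
    field_simp
  rw [hexp, hbase, ← mul_pow]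

theorem exists_pow_mul_exp_pow_le_chainBound (hk : k ≠ 0) (hkN : k ≤ N) (hp : 0 < p)
    (hp1 : p ≤ 1 / 5) (h : √(2 * p / (1 - p)) * (N / k) ≤ 2) :
    ∃ q : ℝ, 1 ≤ q ∧ (p + (1 - p) / q ^ 2) ^ k * Real.exp (q * √(2 * p / (1 - p))) ^ N ≤
      chainBound N k p := by
  have hN : N ≠ 0 := by lia
  have : 0 < 1 - p := by linarith
  -- This `q` makes the exponential factor `e ^ (2 * k)`.
  refine ⟨2 / (√(2 * p / (1 - p)) * (N / k)), (one_le_div (by positivity)).mpr h, ?_⟩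
  rw [pow_mul_exp_pow_eq hk hN hp (by linarith) rfl]
  exact pow_le_chainBound hk hkN hp.le hp1

end Bound

end ChainOfPoWs

theorem mainTheorem3 (κ N k T : ℕ) (hk : 1 ≤ k)
    (hp : ChainOfPoWs.powProb κ T ≤ 3 / 4)
    {Y W : Type*} [Fintype Y] [Fintype W] (x₀ : ChainOfPoWs.Hash κ)
    (A : ChainOfPoWs.Adversary κ N Y W) :
    A.successProb N T x₀ k ≤
      2 * (1 - ChainOfPoWs.powProb κ T) / (Real.pi * k) *
        (((N : ℝ) + k) * Real.exp 1 * Real.sqrt (ChainOfPoWs.powProb κ T) / k) ^ (2 * k) := by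
  have hk0 : k ≠ 0 := Nat.one_le_iff_ne_zero.mp hk
  have hpos := ChainOfPoWs.powProb_pos κ T
  have hlt : ChainOfPoWs.powProb κ T < 1 := by linarith
  change _ ≤ ChainOfPoWs.chainBound N k (ChainOfPoWs.powProb κ T)
  rcases lt_or_ge N k with hNk | hkN
  · rw [A.successProb_eq_zero_of_lt N T x₀ hNk]
    exact ChainOfPoWs.chainBound_nonneg hlt.le
  rcases le_or_gt (1 / 5) (ChainOfPoWs.powProb κ T) with hlarge | hsmall
  · exact (A.successProb_le_one N T x₀ k).trans
      (ChainOfPoWs.one_le_chainBound_of_one_fifth_le hk0 hkN hlarge hp)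
  rcases lt_or_ge 2 (√(2 * ChainOfPoWs.powProb κ T / (1 - ChainOfPoWs.powProb κ T)) * (N / k))
    with hlong | hshort
  · exact (A.successProb_le_one N T x₀ k).trans
      (ChainOfPoWs.one_le_chainBound_of_two_lt hk0 hpos.le hsmall.le hlong)
  · obtain ⟨q, hq, hbound⟩ := ChainOfPoWs.exists_pow_mul_exp_pow_le_chainBound hk0 hkN hpos
      hsmall.le hshort
    exact (A.successProb_le hlt hq N x₀ k).trans hbound
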